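/- Let $d\ge 0$ and let $W^d=\{(x_1,\dots,x_d)\in\mathbb{Z}^d : x_1>\cdots>x_d>0\}$. For $\lambda,\mu\in W^d$ let $b_n(\lambda;\mu)$ be the number of lattice walks of length $n$ from $\lambda$ to $\mu$ that stay in $W^d$ and whose steps are positive or negative unit coordinate vectors $\pm e_i$. For $s\in\mathbb{Z}$ let $$I_s(2t)=[z^s]\exp\bigl(t(z+z^{-1})\bigr)=\sum_{n\ge 0,\ n+s\ge 0}\frac{t^{2n+s}}{n!\,(n+s)!},$$ $$J_s(2t)=[z^s]\,(1+z)\exp\bigl(t(z+z^{-1})\bigr)=I_s(2t)+I_{s-1}(2t).$$ Then the exponential generating function of the number of such walks that start at $\bar{\mathbf 0}=(d,d-1,\dots,1)$ and end anywhere is, as a formal power series in $t$, $$\sum_{n\ge 0}\ \sum_{\mu\in W^d} b_n(\bar{\mathbf 0};\mu)\,\frac{t^n}{n!}=\det\bigl(J_{i-j}(2t)\bigr)_{1\le i,j\le d}.$$ Equivalently, let $\tilde f_n(d)$ be the number of oscillating tableaux of length $n$, of any shape and of height at most $d$, i.e. of sequences $\varnothing=\mu^0,\mu^1,\dots,\mu^n$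 of partitions with at most $d$ parts in which the diagram of each $\mu^k$, $1\le k\le n$, is obtained from that of $\mu^{k-1}$ by adding or removing one square. Then $$\sum_{n\ge 0}\tilde f_n(d)\,\frac{t^n}{n!}=\det\bigl(J_{i-j}(2t)\bigr)_{1\le i,j\le d}.$$ -/

import Mathlib

noncomputable section

/-- The integral points of the Weyl chamber: `W^d = {x ∈ ℤ^d : x₁ > ⋯ > x_d > 0}`. -/
def weylChamber (d : ℕ) : Set (Fin d → ℤ) :=
  {x | StrictAnti x ∧ ∀ i, 0 < x i}

/-- The point `(d, d - 1, …, 1)` of `W^d` (the index `i : Fin d` counts from `0`). -/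
def weylStart (d : ℕ) : Fin d → ℤ :=
  fun i => (d : ℤ) - (i : ℤ)

/-- The Weyl oscillating lattice walks of length `n` from `a` to `b`: sequences
`w₀ = a, w₁, …, w_n = b` of points of `W^d` whose consecutive differences are
`e_i` or `-e_i`, where `e_i` is a unit coordinate vector. -/
def weylWalks (d n : ℕ) (a b : Fin d → ℤ) : Set (Fin (n + 1) → Fin d → ℤ) :=
  {w | w 0 = a ∧ w (Fin.last n) = b ∧ (∀ k, w k ∈ weylChamber d) ∧
    ∀ k : Fin n, ∃ i : Fin d,
      w k.succ = w k.castSucc + Pi.single i 1 ∨ w k.succ = w k.castSucc - Pi.single i 1}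

/-- `b_n(a; b)`, the number of Weyl oscillating lattice walks of length `n` from `a` to `b`. -/
def weylWalkCount (d n : ℕ) (a b : Fin d → ℤ) : ℕ :=
  (weylWalks d n a b).ncard

/-- `ν` is obtained from `μ` by adding one square. -/
def AddsSquare (μ ν : YoungDiagram) : Prop :=
  ∃ c : ℕ × ℕ, c ∉ μ.cells ∧ ν.cells = insert c μ.cells

/-- The oscillating tableaux of length `n`, of height at most `d`, and of any shape: sequences
`∅ = μ⁰, μ¹, …, μⁿ` of Young diagrams with at most `d` rows, each obtained from the
preceding one by adding or removing one square. -/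
def oscillatingTableaux (d n : ℕ) : Set (Fin (n + 1) → YoungDiagram) :=
  {μ | μ 0 = ⊥ ∧ (∀ k, (μ k).colLen 0 ≤ d) ∧
    ∀ k : Fin n, AddsSquare (μ k.castSucc) (μ k.succ) ∨ AddsSquare (μ k.succ) (μ k.castSucc)}

/-- The exponential generating function `∑_{n ≥ 0} u_n tⁿ / n!`. -/
def expGenFun (u : ℕ → ℕ) : PowerSeries ℚ :=
  PowerSeries.mk fun n => (u n : ℚ) / (n.factorial : ℚ)

/-- `exp (t (z + z⁻¹))`, as a power series in `t` over the Laurent polynomials in `z`. -/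
def expKernel : PowerSeries (LaurentPolynomial ℚ) :=
  PowerSeries.rescale (LaurentPolynomial.T 1 + LaurentPolynomial.T (-1))
    (PowerSeries.exp (LaurentPolynomial ℚ))

/-- `[z^s] F`, for `F` a power series in `t` over the Laurent polynomials in `z`. -/
def zCoeff (s : ℤ) (F : PowerSeries (LaurentPolynomial ℚ)) : PowerSeries ℚ :=
  PowerSeries.mk fun n => (PowerSeries.coeff n F).coeff s

/-- `I_s(2t) = ∑_{n ≥ 0, n + s ≥ 0} t^(2n+s) / (n! (n+s)!)`, where `I_s` is the hyperbolic
(modified) Bessel function of the first kind of integer order `s`. In the coefficient of `t^m`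
only the indices `n ≤ m` can contribute. -/
def besselI (s : ℤ) : PowerSeries ℚ :=
  PowerSeries.mk fun m => ∑ n ∈ Finset.range (m + 1),
    if 0 ≤ (n : ℤ) + s ∧ (m : ℤ) = 2 * n + s then
      1 / ((n.factorial : ℚ) * (((n : ℤ) + s).toNat.factorial : ℚ))
    else 0

/-- `J_s(2t) = I_s(2t) + I_{s-1}(2t)`. -/
def besselJ (s : ℤ) : PowerSeries ℚ :=
  besselI s + besselI (s - 1)

end

section

open Finset

/-! By the reflection principle, the walks from `a` are counted by a linear functional of `∏ (z_i ^
a_i - z_i ^ (-a_i)) * (∑ (z_i + z_i⁻¹)) ^ n`. Sign changes are applied to the start. Permutations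
are applied to the end point, through `sortSign`. This `reflectedCount` satisfies the walk
recurrence, vanishes on the walls and is `1` in the chamber at `n = 0`.

At the start `(d, …, 1)` the alternating functional allows the product to be replaced by `1 / d!`
times a determinant, the type `C` Weyl denominator. With `x_i = z_i⁻¹` it factors as `∏ (1 - x_i)
∏_{i<j} (1 - x_i x_j)` times `∏ (1 + z_i) ∏_{i<j} (z_i - z_j)` (`det_subst_T_sub`). Pairing with
`sortSign` amounts to taking the constant term against `∏ x_i ∏_{i<j} (x_i - x_j)` times the sum of
all Schur functions in `x`. Littlewood's product formula for that sum cancels the first factor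
(`functional_sortSign_littlewoodDenom_mul`).

What remains is a constant term with two Vandermonde products. One is unfolded to a monomial,
absorbing `d!`; the other is a determinant with one variable per row. Since `exp (t ∑ (z_i +
z_i⁻¹))` is a product over the variables, the constant term splits entrywise into the series `J`
(`factorial_mul_coeff_det_besselJ`). Oscillating tableaux become these walks when `(d, …, 1)` is
added to the row lengths. -/

/-- The product of `g i j` over the pairs `i < j` of elements of `s`. -/
def pairProd {ι R : Type*} [LinearOrder ι] [CommMonoid R] (s : Finset ι) (g : ι → ι → R) : R :=
  ∏ i ∈ s, ∏ j ∈ s, if i < j then g i j else 1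

/-! ### Products over pairs and Vandermonde determinants -/

section PairProd

variable {ι R : Type*} [LinearOrder ι]

lemma pairProd_insert [CommMonoid R] {k : ι} {t : Finset ι} (hk : k ∉ t) (g : ι → ι → R) :
    pairProd (insert k t) g = pairProd t g * ∏ j ∈ t, if k < j then g k j else g j k := by
  have h1 : ∀ i ∈ t, (∏ j ∈ insert k t, if i < j then g i j else 1) =
      (if i < k then g i k else 1) * ∏ j ∈ t, if i < j then g i j else 1 :=
    fun i _ => prod_insert hk
  have h2 : ∀ j ∈ t, (if k < j then g k j else g j k) =
      (if k < j then g k j else 1) * (if j < k then g j k else 1) := by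
    intro j hj
    have : j ≠ k := fun h => hk (h ▸ hj)
    rcases lt_or_gt_of_ne this with h | h <;> simp [h, h.not_gt]
  rw [pairProd, prod_insert hk, prod_congr rfl h1, prod_insert hk, prod_mul_distrib,
    prod_congr rfl h2, prod_mul_distrib, pairProd]
  simp only [lt_self_iff_false, if_false, one_mul]
  rw [mul_comm, mul_assoc, mul_comm, mul_assoc]

lemma pairProd_erase [CommMonoid R] {k : ι} {s : Finset ι} (hk : k ∈ s) (g : ι → ι → R) :
    pairProd s g = pairProd (s.erase k) g * ∏ j ∈ s.erase k, if k < j then g k j else g j k := by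
  conv_lhs => rw [← insert_erase hk]
  exact pairProd_insert (notMem_erase k s) g

lemma pairProd_congr [CommMonoid R] {s : Finset ι} {g h : ι → ι → R}
    (H : ∀ i ∈ s, ∀ j ∈ s, i < j → g i j = h i j) : pairProd s g = pairProd s h := by
  refine prod_congr rfl fun i hi => prod_congr rfl fun j hj => ?_
  split_ifs with hij
  · exact H i hi j hj hij
  · rfl

lemma pairProd_mul [CommMonoid R] (s : Finset ι) (g h : ι → ι → R) :
    pairProd s (fun i j => g i j * h i j) = pairProd s g * pairProd s h := by
  simp only [pairProd, ← prod_mul_distrib]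
  refine prod_congr rfl fun i _ => prod_congr rfl fun j _ => ?_
  split_ifs <;> simp

lemma map_pairProd {S F : Type*} [CommMonoid R] [CommMonoid S] [FunLike F R S] [MonoidHomClass F R S]
    (f : F) (s : Finset ι) (g : ι → ι → R) :
    f (pairProd s g) = pairProd s fun i j => f (g i j) := by
  simp only [pairProd, map_prod]
  refine prod_congr rfl fun i _ => prod_congr rfl fun j _ => ?_
  split_ifs <;> simp

/-- The sign `(-1) ^ #{j ∈ t | k < j}`. -/
def insertSign (R : Type*) [CommRing R] (k : ι) (t : Finset ι) : R :=
  ∏ j ∈ t, if k < j then -1 else 1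

lemma map_insertSign {S : Type*} [CommRing R] [CommRing S] (f : R →+* S) (k : ι) (t : Finset ι) :
    f (insertSign R k t) = insertSign S k t := by
  rw [insertSign, insertSign, map_prod]
  exact prod_congr rfl fun j _ => by split_ifs <;> simp

lemma pairProd_sub_erase [CommRing R] {k : ι} {s : Finset ι} (hk : k ∈ s) (v : ι → R) :
    pairProd s (fun i j => v i - v j) = pairProd (s.erase k) (fun i j => v i - v j) *
      (insertSign R k (s.erase k) * ∏ j ∈ s.erase k, (v j - v k)) := by
  rw [pairProd_erase hk, insertSign, ← prod_mul_distrib]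
  congr 1
  refine prod_congr rfl fun j _ => ?_
  split_ifs <;> ring

lemma pairProd_univ_sub {d : ℕ} [CommRing R] (v : Fin d → R) :
    pairProd univ (fun i j => v i - v j) =
      (Matrix.of fun i j : Fin d => v i ^ (d - 1 - (j : ℕ))).det := by
  have h1 : (Matrix.of fun i j : Fin d => v i ^ (d - 1 - (j : ℕ))) =
      (Matrix.projVandermonde (1 : Fin d → R) v) := by
    ext i j
    rw [Matrix.projVandermonde_apply]
    simp only [Matrix.of_apply, Pi.one_apply, one_pow, one_mul, Fin.val_rev]
    congr 1
    omega
  rw [h1, Matrix.det_projVandermonde]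
  refine prod_congr rfl fun i _ => ?_
  rw [← prod_filter]
  refine prod_congr (by ext; simp) fun j _ => by simp

end PairProd

/-! ### A rational identity from Lagrange interpolation -/

section Lagrange

-- Interpolate `∏ (1 - x_j t)`, of degree at most `#s`, at the `#s + 1` nodes `x_k` and `-1`, and
-- evaluate at `t = 0`. The node `-1` contributes `∏ x_j`, and the node `x_k` the `k`-th summand.
open Polynomial in
lemma sum_prod_mul_div_eq_one_sub_prod {ι K : Type*} [DecidableEq ι] [Field K] (s : Finset ι)
    (x : ι → K) (hx : Set.InjOn x s) (hx1 : ∀ i ∈ s, x i ≠ -1) :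
    ∑ k ∈ s, (1 - x k) * ∏ j ∈ s.erase k, (1 - x j * x k) * x j / (x j - x k) =
      1 - ∏ j ∈ s, x j := by
  set v : Option ι → K := fun o => o.elim (-1) x with hv
  have hvi : Set.InjOn v (insertNone s) := by
    rintro (_ | a) ha (_ | b) hb h
    · rfl
    · exact absurd h.symm (hx1 b (by simpa using hb))
    · exact absurd h (hx1 a (by simpa using ha))
    · exact congrArg some (hx (by simpa using ha) (by simpa using hb) h)
  set p : K[X] := ∏ j ∈ s, (1 - C (x j) * X) with hp
  have hdeg : p.degree < #(insertNone s) := by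
    refine lt_of_le_of_lt (degree_prod_le _ _) ?_
    refine lt_of_le_of_lt (b := (#s : WithBot ℕ)) ?_ (by simp; exact_mod_cast Nat.lt_succ_self _)
    calc _ ≤ ∑ j ∈ s, (1 : WithBot ℕ) := by
          refine sum_le_sum fun j _ => ?_
          refine (degree_sub_le _ _).trans (max_le (degree_one_le.trans zero_le_one) ?_)
          exact (degree_C_mul_X_le _)
      _ = #s := by simp
  have h0 := congrArg (eval 0) (Lagrange.eq_interpolate hvi hdeg)
  have e0 : eval 0 p = 1 := by simp [hp, eval_prod]
  rw [e0, Lagrange.interpolate_apply, eval_finsetSum, sum_insertNone] at h0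
  have hb : ∀ o, eval 0 (Lagrange.basis (insertNone s) v o) =
      ∏ j ∈ (insertNone s).erase o, (v j / (v j - v o)) := by
    intro o
    rw [Lagrange.basis, eval_prod]
    refine prod_congr rfl fun j hj => ?_
    rw [Lagrange.basisDivisor]
    simp only [eval_mul, eval_C, eval_sub, eval_X, zero_sub]
    rw [← neg_sub (v j) (v o), inv_neg]
    ring
  simp only [eval_mul, eval_C, hb] at h0
  have hnone : (insertNone s).erase none = s.map Function.Embedding.some := by
    ext (_ | a) <;> simp
  have hsome : ∀ k ∈ s, (insertNone s).erase (some k) = insertNone (s.erase k) := by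
    intro k _
    ext (_ | a) <;> simp
  have t1 : eval (v none) p * ∏ j ∈ (insertNone s).erase none, (v j / (v j - v none)) =
      ∏ j ∈ s, x j := by
    rw [hnone, prod_map, hp, eval_prod, ← prod_mul_distrib]
    refine prod_congr rfl fun j hj => ?_
    have : x j + 1 ≠ 0 := fun h => hx1 j hj (eq_neg_of_add_eq_zero_left h)
    simp only [eval_sub, eval_one, eval_mul, eval_C, eval_X, hv, Option.elim,
      Function.Embedding.some_apply, sub_neg_eq_add]
    field_simp
    ring
  rw [t1] at h0
  rw [eq_sub_iff_add_eq, add_comm]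
  refine Eq.trans ?_ h0.symm
  congr 1
  refine sum_congr rfl fun k hk => ?_
  have hk1 : x k + 1 ≠ 0 := fun h => hx1 k hk (eq_neg_of_add_eq_zero_left h)
  rw [hsome k hk, prod_insertNone, hp, eval_prod, ← mul_prod_erase _ _ hk]
  simp only [eval_sub, eval_one, eval_mul, eval_C, eval_X, hv, Option.elim]
  have h2 : (-1 : K) / (-1 - x k) = 1 / (x k + 1) := by
    rw [← neg_div_neg_eq]; congr 1 <;> ring
  rw [h2]
  simp only [mul_div_assoc, prod_mul_distrib]
  field_simp
  ring

/-- The previous identity multiplied by the Vandermonde product, checked in the fraction field. It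
is the inductive step for Littlewood's identity, where the index `k` is removed. -/
lemma sum_insertSign_mul_pairProd {ι R : Type*} [LinearOrder ι] [CommRing R] [IsDomain R]
    (s : Finset ι) (x : ι → R) (hx : Set.InjOn x s) (hx1 : ∀ i ∈ s, x i ≠ -1) :
    ∑ k ∈ s, insertSign R k (s.erase k) * ((1 - x k) * ∏ j ∈ s.erase k, (1 - x j * x k)) *
      ((∏ j ∈ s.erase k, x j) * pairProd (s.erase k) (fun i j => x i - x j)) =
      (1 - ∏ j ∈ s, x j) * pairProd s (fun i j => x i - x j) := by
  set φ := algebraMap R (FractionRing R)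
  have hφ : Function.Injective φ := IsFractionRing.injective R _
  apply hφ
  have key := sum_prod_mul_div_eq_one_sub_prod s (fun i => φ (x i))
    (fun a ha b hb h => hx ha hb (hφ h)) (fun i hi h => hx1 i hi (hφ (by simpa using h)))
  simp only [map_sum, map_mul, map_sub, map_one, map_prod, map_pairProd, map_insertSign]
  rw [← key, sum_mul]
  refine sum_congr rfl fun k hk => ?_
  rw [pairProd_sub_erase hk (fun i => φ (x i))]
  have hne : ∏ j ∈ s.erase k, (φ (x j) - φ (x k)) ≠ 0 := by
    refine prod_ne_zero_iff.2 fun j hj => sub_ne_zero.2 fun h => ?_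
    exact (mem_erase.1 hj).1 (hx (mem_erase.1 hj).2 hk (hφ h))
  rw [prod_div_distrib, prod_mul_distrib]
  field_simp

end Lagrange

/-- Laurent polynomials over `ℚ` in the variables `z_i`, `i : Fin d`. -/
abbrev MvLaurent (d : ℕ) : Type := AddMonoidAlgebra ℚ (Fin d → ℤ)

/-! ### Linear functionals on Laurent polynomials and Littlewood's identity -/

namespace MvLaurent

variable {d : ℕ}

/-- The Laurent monomial with exponent vector `a`. -/
noncomputable def mono (a : Fin d → ℤ) : MvLaurent d := AddMonoidAlgebra.single a 1

lemma mono_zero : mono (0 : Fin d → ℤ) = 1 := rfl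

lemma mono_add (a b : Fin d → ℤ) : mono (a + b) = mono a * mono b := by
  simp [mono, AddMonoidAlgebra.single_mul_single]

lemma mono_injective : Function.Injective (mono : (Fin d → ℤ) → MvLaurent d) :=
  AddMonoidAlgebra.single_left_injective one_ne_zero

lemma mono_sum {ι : Type*} (s : Finset ι) (f : ι → Fin d → ℤ) :
    mono (∑ i ∈ s, f i) = ∏ i ∈ s, mono (f i) := by
  classical
  induction s using Finset.induction_on with
  | empty => simp [mono_zero]
  | insert a s ha ih => rw [sum_insert ha, prod_insert ha, mono_add, ih]

lemma mono_nsmul (n : ℕ) (a : Fin d → ℤ) : mono (n • a) = mono a ^ n := by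
  induction n with
  | zero => simp [mono_zero]
  | succ n ih => rw [succ_nsmul, mono_add, ih, pow_succ]

/-- The linear functional on Laurent polynomials that takes the value `q a` at the monomial with
exponent vector `a`. -/
noncomputable def functional (q : (Fin d → ℤ) → ℚ) : MvLaurent d →ₗ[ℚ] ℚ :=
  Finsupp.linearCombination ℚ q ∘ₗ (AddMonoidAlgebra.coeffLinearEquiv ℚ).toLinearMap

@[simp] lemma functional_mono (q : (Fin d → ℤ) → ℚ) (a : Fin d → ℤ) :
    functional q (mono a) = q a := by
  simp [functional, mono]

/-- Two linear maps that agree on the monomials agree. -/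
lemma linearMap_ext {V : Type*} [AddCommGroup V] [Module ℚ V] {f g : MvLaurent d →ₗ[ℚ] V}
    (h : ∀ a, f (mono a) = g (mono a)) (p : MvLaurent d) : f p = g p := by
  induction p using AddMonoidAlgebra.induction_linear with
  | zero => simp
  | add p q hp hq => rw [map_add, map_add, hp, hq]
  | single a r =>
    have : (AddMonoidAlgebra.single a r : MvLaurent d) = r • mono a := by
      simp [mono]
    rw [this, map_smul, map_smul, h]

/-- The constant term. -/
noncomputable def constTerm : MvLaurent d →ₗ[ℚ] ℚ := functional fun a => if a = 0 then 1 else 0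

/-- The inverse of the variable `z_i`. -/
noncomputable def xvar (i : Fin d) : MvLaurent d := mono (-Pi.single i 1)

/-- The indicator vector of `s`. -/
def indVec (s : Finset (Fin d)) : Fin d → ℤ := fun i => if i ∈ s then 1 else 0

lemma prod_xvar (s : Finset (Fin d)) : ∏ i ∈ s, xvar i = mono (-indVec s) := by
  have : -indVec s = ∑ i ∈ s, -(Pi.single i 1 : Fin d → ℤ) := by
    ext j
    simp [indVec, Finset.sum_apply, Pi.single_apply]
  rw [this, mono_sum]
  rfl

/-- The sign of the permutation sorting `a` decreasingly, for `a` positive with distinct entries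
on `s` and zero off `s`; zero for other `a`. -/
def sortSign (s : Finset (Fin d)) (a : Fin d → ℤ) : ℚ :=
  if ∀ i, (i ∈ s → 0 < a i) ∧ (i ∉ s → a i = 0) then
    pairProd s fun i j => ((a i - a j).sign : ℚ) else 0

lemma sortSign_eq_zero {s : Finset (Fin d)} {a : Fin d → ℤ} {k : Fin d} (hk : k ∈ s)
    (ha : a k ≤ 0) : sortSign s a = 0 :=
  if_neg fun h => absurd ((h k).1 hk) ha.not_gt

lemma sortSign_eq_zero' {s : Finset (Fin d)} {a : Fin d → ℤ} {k : Fin d} (hk : k ∉ s)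
    (ha : a k ≠ 0) : sortSign s a = 0 :=
  if_neg fun h => ha ((h k).2 hk)

/-- Lowering all entries by one preserves their order, so the sign changes only if some entry is
`1`. If `k` is the only such position, its entry becomes `0` and `a - indVec s` is supported on
`s.erase k`; being smallest, `a k` contributes `-1` for each later `j`. -/
lemma sortSign_sub_indVec (s : Finset (Fin d)) (a : Fin d → ℤ) :
    sortSign s a - sortSign s (a - indVec s) =
      ∑ k ∈ s, insertSign ℚ k (s.erase k) * sortSign (s.erase k) (a - indVec s) := by
  have hin : ∀ i ∈ s, (a - indVec s) i = a i - 1 := fun i hi => by simp [indVec, hi]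
  have hout : ∀ i ∉ s, (a - indVec s) i = a i := fun i hi => by simp [indVec, hi]
  by_cases h : ∀ i, (i ∈ s → 0 < a i) ∧ (i ∉ s → a i = 0)
  · by_cases h1 : ∃ k ∈ s, a k = 1
    · obtain ⟨k, hk, hak⟩ := h1
      rw [sortSign_eq_zero (a := a - indVec s) hk (by rw [hin k hk, hak]; simp), sub_zero,
        sum_eq_single_of_mem k hk]
      · have hk' : k ∉ s.erase k := notMem_erase k s
        -- Two entries equal to `1` make both sides vanish.
        by_cases h2 : ∃ j ∈ s.erase k, a j = 1
        · obtain ⟨j, hj, haj⟩ := h2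
          rw [sortSign_eq_zero (s := s.erase k) (a := a - indVec s) hj
            (by rw [hin j (mem_of_mem_erase hj), haj]; simp), mul_zero, sortSign, if_pos h,
            pairProd_erase hk, prod_eq_zero hj (by simp [hak, haj]), mul_zero]
        · push Not at h2
          have hpos : ∀ j ∈ s.erase k, 1 < a j := fun j hj =>
            lt_of_le_of_ne ((h j).1 (mem_of_mem_erase hj)) (h2 j hj).symm
          rw [sortSign, if_pos h, sortSign, if_pos, pairProd_erase hk, insertSign, mul_comm]
          · congr 1
            · refine prod_congr rfl fun j hj => ?_
              have := hpos j hj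
              split_ifs
              · rw [Int.sign_eq_neg_one_of_neg (by omega)]; simp
              · rw [Int.sign_eq_one_of_pos (by omega)]; simp
            · refine pairProd_congr fun i hi j hj _ => ?_
              rw [hin i (mem_of_mem_erase hi), hin j (mem_of_mem_erase hj), sub_sub_sub_cancel_right]
          · intro i
            refine ⟨fun hi => ?_, fun hi => ?_⟩
            · rw [hin i (mem_of_mem_erase hi)]
              have := hpos i hi
              omega
            · by_cases hik : i = k
              · rw [hik, hin k hk, hak, sub_self]
              · have his : i ∉ s := fun hs => hi (mem_erase.2 ⟨hik, hs⟩)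
                rw [hout i his, (h i).2 his]
      · intro j hj hjk
        rw [sortSign_eq_zero (mem_erase.2 ⟨hjk.symm, hk⟩) (by rw [hin k hk, hak]; simp), mul_zero]
    · push Not at h1
      have hpos : ∀ j ∈ s, 1 < a j := fun j hj => lt_of_le_of_ne ((h j).1 hj) (h1 j hj).symm
      rw [sum_eq_zero, sub_eq_zero, sortSign, sortSign, if_pos h, if_pos]
      · refine pairProd_congr fun i hi j hj _ => ?_
        rw [hin i hi, hin j hj, sub_sub_sub_cancel_right]
      · refine fun i => ⟨fun hi => ?_, fun hi => ?_⟩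
        · rw [hin i hi]
          have := hpos i hi
          omega
        · rw [hout i hi, (h i).2 hi]
      · intro k hk
        rw [sortSign_eq_zero' (notMem_erase k s) (by rw [hin k hk]; have := hpos k hk; omega),
          mul_zero]
  · push Not at h
    obtain ⟨i, hi⟩ := h
    by_cases his : i ∈ s
    · have hai : a i ≤ 0 := by
        by_contra hc
        exact (hi (fun _ => by omega)).1 his
      rw [sortSign_eq_zero his hai, sortSign_eq_zero his (by rw [hin i his]; omega), sub_self,
        sum_eq_zero]
      intro k hk
      by_cases hik : i = k
      · subst hik
        rw [sortSign_eq_zero' (notMem_erase i s) (by rw [hin i his]; omega), mul_zero]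
      · rw [sortSign_eq_zero (mem_erase.2 ⟨hik, his⟩) (by rw [hin i his]; omega), mul_zero]
    · have hai : a i ≠ 0 := (hi fun h => absurd h his).2
      rw [sortSign_eq_zero' his hai, sortSign_eq_zero' his (by rwa [hout i his]), sub_self,
        sum_eq_zero]
      intro k hk
      rw [sortSign_eq_zero' (fun h => his (mem_of_mem_erase h)) (by rwa [hout i his]), mul_zero]

lemma functional_sortSign_one_sub (s : Finset (Fin d)) (g : MvLaurent d) :
    functional (sortSign s) ((1 - ∏ i ∈ s, xvar i) * g) =
      ∑ k ∈ s, insertSign ℚ k (s.erase k) *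
        functional (sortSign (s.erase k)) ((∏ i ∈ s, xvar i) * g) := by
  have := linearMap_ext (d := d)
    (f := functional (sortSign s) ∘ₗ LinearMap.mulLeft ℚ (1 - ∏ i ∈ s, xvar i))
    (g := ∑ k ∈ s, insertSign ℚ k (s.erase k) •
      (functional (sortSign (s.erase k)) ∘ₗ LinearMap.mulLeft ℚ (∏ i ∈ s, xvar i))) ?_ g
  · simpa [LinearMap.sum_apply] using this
  · intro a
    have e : ∀ b, mono (-indVec s) * mono a = mono b ↔ b = a - indVec s := by
      intro b
      rw [← mono_add, mono_injective.eq_iff]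
      constructor <;> rintro h
      · rw [← h]; abel
      · rw [h]; abel
    have := sortSign_sub_indVec s a
    simp only [LinearMap.comp_apply, LinearMap.mulLeft_apply, LinearMap.sum_apply,
      LinearMap.smul_apply, prod_xvar, sub_mul, one_mul, (e _).2 rfl, map_sub, functional_mono,
      smul_eq_mul]
    exact this

/-- Multiplying by `∏ x_i` lowers the exponent of `z_k`, and `g` has finitely many monomials. -/
lemma exists_functional_pow_mul_eq_zero {q : (Fin d → ℤ) → ℚ} {s : Finset (Fin d)} {k : Fin d}
    (hk : k ∈ s) {C : ℤ} (hq : ∀ a, a k < C → q a = 0) (g : MvLaurent d) :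
    ∃ N : ℕ, ∀ m ≥ N, functional q ((∏ i ∈ s, xvar i) ^ m * g) = 0 := by
  induction g using AddMonoidAlgebra.induction_linear with
  | zero => simp
  | add p q hp hq =>
    obtain ⟨N, hN⟩ := hp
    obtain ⟨N', hN'⟩ := hq
    refine ⟨max N N', fun m hm => ?_⟩
    rw [mul_add, map_add, hN m (le_trans (le_max_left _ _) hm),
      hN' m (le_trans (le_max_right _ _) hm), add_zero]
  | single a r =>
    refine ⟨(a k - C + 1).toNat, fun m hm => ?_⟩
    have : (AddMonoidAlgebra.single a r : MvLaurent d) = r • mono a := by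
      simp [mono]
    rw [this, mul_smul_comm, map_smul, prod_xvar, ← mono_nsmul, ← mono_add, functional_mono, hq,
      smul_zero]
    rw [Pi.add_apply, Pi.smul_apply, Pi.neg_apply, indVec, if_pos hk, nsmul_eq_mul]
    have := Int.self_le_toNat (a k - C + 1)
    omega

/-- `∏ (1 - x_i) ∏_{i<j} (1 - x_i x_j)` -/
noncomputable def littlewoodDenom (s : Finset (Fin d)) : MvLaurent d :=
  (∏ i ∈ s, (1 - xvar i)) * pairProd s fun i j => 1 - xvar i * xvar j

lemma littlewoodDenom_erase {s : Finset (Fin d)} {k : Fin d} (hk : k ∈ s) :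
    littlewoodDenom s = littlewoodDenom (s.erase k) *
      ((1 - xvar k) * ∏ j ∈ s.erase k, (1 - xvar j * xvar k)) := by
  have : (∏ j ∈ s.erase k, if k < j then 1 - xvar k * xvar j else 1 - xvar j * xvar k) =
      ∏ j ∈ s.erase k, (1 - xvar j * xvar k) :=
    prod_congr rfl fun j _ => by split_ifs <;> ring
  rw [littlewoodDenom, littlewoodDenom, ← mul_prod_erase _ _ hk, pairProd_erase hk, this]
  ring

lemma xvar_injective : Function.Injective (xvar : Fin d → MvLaurent d) := by
  intro i j h
  have := congrFun (neg_injective (mono_injective h)) i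
  by_contra hij
  simp [hij] at this

lemma xvar_ne_neg_one (i : Fin d) : xvar i ≠ -1 := by
  intro h
  have := congrArg constTerm h
  rw [map_neg, ← mono_zero, xvar, constTerm, functional_mono, functional_mono] at this
  norm_num at this

/-- Littlewood's identity for the sum of all Schur functions, cleared of denominators. -/
theorem functional_sortSign_littlewoodDenom_mul (s : Finset (Fin d)) (g : MvLaurent d) :
    functional (sortSign s) (littlewoodDenom s * g) =
      constTerm ((∏ i ∈ s, xvar i) * pairProd s (fun i j => xvar i - xvar j) * g) := by
  induction s using Finset.strongInduction generalizing g with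
  | H s ih =>
  rcases s.eq_empty_or_nonempty with rfl | hs
  · have : sortSign (∅ : Finset (Fin d)) = fun a => if a = 0 then 1 else 0 := by
      ext a
      simp [sortSign, pairProd, funext_iff]
    simp [littlewoodDenom, pairProd, constTerm, this]
  · set X := ∏ i ∈ s, xvar i with hX
    set D := pairProd s (fun i j : Fin d => xvar i - xvar j) with hD
    -- The induction on `s` gives the identity only on multiples of `1 - X`.
    have step : ∀ h : MvLaurent d, functional (sortSign s) (littlewoodDenom s * ((1 - X) * h)) =
        constTerm (X * D * ((1 - X) * h)) := by
      intro h
      rw [mul_left_comm, functional_sortSign_one_sub s]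
      have h1 : ∀ k ∈ s, insertSign ℚ k (s.erase k) *
          functional (sortSign (s.erase k)) (X * (littlewoodDenom s * h)) =
          constTerm (insertSign (MvLaurent d) k (s.erase k) *
            ((1 - xvar k) * ∏ j ∈ s.erase k, (1 - xvar j * xvar k)) *
            ((∏ j ∈ s.erase k, xvar j) * pairProd (s.erase k) (fun i j => xvar i - xvar j)) *
              (X * h)) := by
        intro k hk
        have e1 : X * (littlewoodDenom s * h) = littlewoodDenom (s.erase k) *
            (((1 - xvar k) * ∏ j ∈ s.erase k, (1 - xvar j * xvar k)) * (X * h)) := by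
          rw [littlewoodDenom_erase hk]; ring
        rw [e1, ih _ (erase_ssubset hk),
          ← map_insertSign (algebraMap ℚ (MvLaurent d)) k (s.erase k), ← smul_eq_mul, ← map_smul,
          Algebra.smul_def]
        congr 1
        ring
      rw [sum_congr rfl h1, ← map_sum, ← sum_mul,
        sum_insertSign_mul_pairProd s xvar xvar_injective.injOn fun i _ => xvar_ne_neg_one i]
      congr 1
      ring
    -- Hence the difference of the two sides is unchanged when `g` is multiplied by `X`. For high
    -- powers of `X` both sides vanish, so the difference is zero.
    have shift : ∀ m : ℕ, functional (sortSign s) (littlewoodDenom s * (X ^ m * g)) -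
        constTerm (X * D * (X ^ m * g)) =
        functional (sortSign s) (littlewoodDenom s * g) - constTerm (X * D * g) := by
      intro m
      induction m with
      | zero => simp
      | succ m ihm =>
        rw [← ihm]
        have := step (X ^ m * g)
        rw [sub_mul, one_mul, mul_sub, mul_sub, map_sub, map_sub] at this
        rw [pow_succ', mul_assoc]
        linarith
    obtain ⟨k, hk⟩ := hs
    obtain ⟨N, hN⟩ := exists_functional_pow_mul_eq_zero (q := sortSign s) hk (C := 0)
      (fun a ha => sortSign_eq_zero hk ha.le) (littlewoodDenom s * g)
    obtain ⟨N', hN'⟩ := exists_functional_pow_mul_eq_zero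
      (q := fun a : Fin d → ℤ => if a = 0 then 1 else 0) hk (C := 0)
      (fun a ha => if_neg fun h => by simp [h] at ha) (X * D * g)
    have h0 := shift (max N N')
    rw [mul_left_comm, hN _ (le_max_left _ _), mul_left_comm (X * D), constTerm,
      hN' _ (le_max_right _ _), sub_zero] at h0
    exact sub_eq_zero.1 h0.symm

end MvLaurent

/-! ### Chebyshev polynomials and the Vandermonde determinant -/

section Chebyshev

open Polynomial

lemma natDegree_chebyshevS_and_monic (R : Type*) [CommRing R] [Nontrivial R] (n : ℕ) :
    ((Chebyshev.S R n).natDegree = n ∧ (Chebyshev.S R n).Monic) := by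
  induction n using Nat.twoStepInduction with
  | zero => simp
  | one => simp [monic_X]
  | more n ih0 ih1 =>
    have hm : (X * Chebyshev.S R (n + 1 : ℕ)).Monic := monic_X.mul ih1.2
    have hd : (X * Chebyshev.S R (n + 1 : ℕ)).natDegree = n + 2 := by
      rw [monic_X.natDegree_mul ih1.2, ih1.1, natDegree_X]; ring
    have hlt : (Chebyshev.S R n).degree < (X * Chebyshev.S R (n + 1 : ℕ)).degree := by
      rw [degree_eq_natDegree ih0.2.ne_zero, degree_eq_natDegree hm.ne_zero, hd, ih0.1]
      exact_mod_cast (by omega)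
    have e : Chebyshev.S R ((n + 2 : ℕ) : ℤ) =
        X * Chebyshev.S R (n + 1 : ℕ) - Chebyshev.S R n := by
      push_cast
      exact Chebyshev.S_add_two R n
    rw [e]
    refine ⟨?_, hm.sub_of_left hlt⟩
    rw [natDegree_sub_eq_left_of_natDegree_lt, hd]
    rw [ih0.1, hd]; omega

/-- Monic polynomials of degrees `0, …, d - 1` differ from the powers by unitriangular column
operations. Both matrices have reversed columns, so the same sign appears on each side. -/
lemma det_eval_chebyshevS {R : Type*} [CommRing R] [Nontrivial R] {d : ℕ} (w : Fin d → R) :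
    (Matrix.of fun i j : Fin d => (Chebyshev.S R (d - 1 - j : ℕ)).eval (w i)).det =
      pairProd univ fun i j => w i - w j := by
  have h := Matrix.det_eval_matrixOfPolynomials_eq_det_vandermonde w
    (fun j => Chebyshev.S R (j : ℕ)) (fun j => (natDegree_chebyshevS_and_monic R j).1)
    (fun j => (natDegree_chebyshevS_and_monic R j).2)
  have h1 : (Matrix.of fun i j : Fin d => (Chebyshev.S R (d - 1 - j : ℕ)).eval (w i)) =
      (Matrix.of fun i j : Fin d => (Chebyshev.S R (j : ℕ)).eval (w i)).submatrix id
        Fin.revPerm := by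
    ext i j
    simp only [Matrix.of_apply, Matrix.submatrix_apply, id, Fin.revPerm_apply, Fin.val_rev]
    rw [show d - 1 - (j : ℕ) = d - ((j : ℕ) + 1) by omega]
  have h2 : (Matrix.of fun i j : Fin d => w i ^ (d - 1 - (j : ℕ))) =
      (Matrix.vandermonde w).submatrix id Fin.revPerm := by
    ext i j
    simp only [Matrix.of_apply, Matrix.submatrix_apply, id, Fin.revPerm_apply, Fin.val_rev,
      Matrix.vandermonde_apply]
    congr 1
    omega
  rw [pairProd_univ_sub, h1, h2, Matrix.det_permute', Matrix.det_permute', h]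

open LaurentPolynomial in
lemma laurentT_sub_eq_mul_eval_chebyshevS (n : ℕ) :
    (T (n + 1) - T (-(n + 1)) : LaurentPolynomial ℚ) =
      (T 1 - T (-1)) * (Chebyshev.S (LaurentPolynomial ℚ) n).eval (T 1 + T (-1)) := by
  induction n using Nat.twoStepInduction with
  | zero => simp
  | one =>
    simp only [Nat.cast_one, Chebyshev.S_one, eval_X, sub_mul, mul_add, ← T_add]
    norm_num
  | more n ih0 ih1 =>
    have e : Chebyshev.S (LaurentPolynomial ℚ) ((n + 2 : ℕ) : ℤ) =
        X * Chebyshev.S (LaurentPolynomial ℚ) (n + 1 : ℕ) -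
          Chebyshev.S (LaurentPolynomial ℚ) n := by
      push_cast
      exact Chebyshev.S_add_two _ n
    rw [e, eval_sub, eval_mul, eval_X, mul_sub, mul_left_comm, ← ih0, ← ih1]
    simp only [add_mul, mul_sub, ← T_add]
    push_cast
    have e1 : (1 : ℤ) + (n + 1 + 1) = n + 2 + 1 := by ring
    have e2 : (1 : ℤ) + -(n + 1 + 1) = -(n + 1) := by ring
    have e3 : (-1 : ℤ) + (n + 1 + 1) = n + 1 := by ring
    have e4 : (-1 : ℤ) + -(n + 1 + 1) = -(n + 2 + 1) := by ring
    rw [e1, e2, e3, e4]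
    ring

end Chebyshev

lemma pairProd_univ_sub_comp_perm {R : Type*} [CommRing R] {d : ℕ} (v : Fin d → R)
    (σ : Equiv.Perm (Fin d)) :
    pairProd univ (fun i j => v (σ i) - v (σ j)) =
      (Equiv.Perm.sign σ : R) * pairProd univ (fun i j => v i - v j) := by
  rw [pairProd_univ_sub (fun i => v (σ i)), pairProd_univ_sub v, ← Matrix.det_permute]
  rfl

/-! ### Alternating functionals and the Weyl denominator -/

namespace MvLaurent

variable {d : ℕ}

open LaurentPolynomial (T)

/-- Substitution of the variable `z_i` into a Laurent polynomial in one variable. -/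
noncomputable def subst (i : Fin d) : LaurentPolynomial ℚ →ₐ[ℚ] MvLaurent d :=
  AddMonoidAlgebra.mapDomainAlgHom ℚ ℚ (AddMonoidHom.single (fun _ : Fin d => ℤ) i)

@[simp] lemma subst_T (i : Fin d) (n : ℤ) : subst i (T n) = mono (Pi.single i n) := by
  rw [subst, T]
  simp [mono, -LaurentPolynomial.single_eq_C_mul_T]

/-- The action of a permutation of the variables. -/
noncomputable def permVars (σ : Equiv.Perm (Fin d)) : MvLaurent d →ₐ[ℚ] MvLaurent d :=
  AddMonoidAlgebra.mapDomainAlgHom ℚ ℚ (LinearMap.funLeft ℤ ℤ σ).toAddMonoidHom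

@[simp] lemma permVars_mono (σ : Equiv.Perm (Fin d)) (a : Fin d → ℤ) :
    permVars σ (mono a) = mono (a ∘ σ) := by
  simp [permVars, mono]
  rfl

lemma single_comp_perm (σ : Equiv.Perm (Fin d)) (i : Fin d) (n : ℤ) :
    (Pi.single i n : Fin d → ℤ) ∘ σ = Pi.single (σ.symm i) n := by
  ext j
  simp [Pi.single_apply, Equiv.eq_symm_apply]

lemma permVars_subst (σ : Equiv.Perm (Fin d)) (i : Fin d) (u : LaurentPolynomial ℚ) :
    permVars σ (subst i u) = subst (σ.symm i) u := by
  have : (permVars σ).comp (subst i) = subst (σ.symm i) := by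
    apply AddMonoidAlgebra.algHom_ext
    · intro n
      change permVars σ (subst i (T n)) = subst (σ.symm i) (T n)
      rw [subst_T, subst_T, permVars_mono, single_comp_perm]
    · exact Subsingleton.elim _ _
  exact DFunLike.congr_fun this u

lemma xvar_eq_subst (i : Fin d) : xvar i = subst i (T (-1)) := by
  rw [subst_T, Pi.single_neg, xvar]

lemma permVars_xvar (σ : Equiv.Perm (Fin d)) (i : Fin d) :
    permVars σ (xvar i) = xvar (σ.symm i) := by
  rw [xvar_eq_subst, permVars_subst, ← xvar_eq_subst]

lemma permVars_prod_subst (σ : Equiv.Perm (Fin d)) (u : LaurentPolynomial ℚ) :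
    permVars σ (∏ i, subst i u) = ∏ i, subst i u := by
  simp only [map_prod, permVars_subst]
  exact Equiv.prod_comp σ.symm fun i => subst i u

lemma permVars_sum_subst (σ : Equiv.Perm (Fin d)) (u : LaurentPolynomial ℚ) :
    permVars σ (∑ i, subst i u) = ∑ i, subst i u := by
  simp only [map_sum, permVars_subst]
  exact Equiv.sum_comp σ.symm fun i => subst i u

/-- A functional is alternating if permuting the variables multiplies it by the sign. -/
def IsAlternating (L : MvLaurent d →ₗ[ℚ] ℚ) : Prop :=
  ∀ (σ : Equiv.Perm (Fin d)) (p : MvLaurent d),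
    L (permVars σ p) = ((Equiv.Perm.sign σ : ℤ) : ℚ) * L p

lemma sortSign_univ_comp_perm (σ : Equiv.Perm (Fin d)) (a : Fin d → ℤ) :
    sortSign univ (a ∘ σ) = ((Equiv.Perm.sign σ : ℤ) : ℚ) * sortSign univ a := by
  have hiff : (∀ i, (i ∈ univ → 0 < (a ∘ σ) i) ∧ (i ∉ univ → (a ∘ σ) i = 0)) ↔
      ∀ i, (i ∈ univ → 0 < a i) ∧ (i ∉ univ → a i = 0) := by
    simp only [mem_univ, forall_const, not_true_eq_false, false_imp_iff, and_true,
      Function.comp_apply]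
    exact σ.forall_congr_left.trans (by simp)
  have hs : ∀ b : Fin d → ℤ, (pairProd univ fun i j => ((b i - b j).sign : ℚ)) =
      ((pairProd univ fun i j => b i - b j : ℤ).sign : ℚ) := by
    intro b
    -- `Int.sign` is multiplicative, so the product of signs is the sign of an integer Vandermonde
    -- product, which is alternating.
    let f : ℤ →* ℤ := ⟨⟨Int.sign, Int.sign_one⟩, Int.sign_mul⟩
    change _ = ((Int.castRingHom ℚ) (f _))
    rw [map_pairProd, map_pairProd]
    rfl
  unfold sortSign
  by_cases h : ∀ i, (i ∈ univ → 0 < a i) ∧ (i ∉ univ → a i = 0)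
  · rw [if_pos h, if_pos (hiff.2 h), hs, hs]
    have := pairProd_univ_sub_comp_perm a σ
    simp only [Function.comp_apply]
    rw [this, Int.sign_mul]
    rcases Int.units_eq_one_or (Equiv.Perm.sign σ) with h | h <;> simp [h]
  · rw [if_neg h, if_neg (fun h' => h (hiff.1 h')), mul_zero]

lemma isAlternating_functional_sortSign :
    IsAlternating (functional (sortSign (univ : Finset (Fin d)))) := by
  intro σ p
  have := linearMap_ext (f := functional (sortSign univ) ∘ₗ (permVars σ).toLinearMap)
    (g := ((Equiv.Perm.sign σ : ℤ) : ℚ) • functional (sortSign univ)) (fun a => by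
      simp [sortSign_univ_comp_perm]) p
  simpa using this

lemma constTerm_permVars (σ : Equiv.Perm (Fin d)) (p : MvLaurent d) :
    constTerm (permVars σ p) = constTerm p := by
  refine linearMap_ext (f := constTerm ∘ₗ (permVars σ).toLinearMap) (fun a => ?_) p
  have : a ∘ σ = 0 ↔ a = 0 := by
    simp only [funext_iff, Function.comp_apply, Pi.zero_apply]
    exact σ.forall_congr_left.trans (by simp)
  simp [constTerm, this]

lemma permVars_pairProd_xvar (σ : Equiv.Perm (Fin d)) :
    permVars σ (pairProd univ fun i j => xvar i - xvar j) =
      ((Equiv.Perm.sign σ : ℤ) : MvLaurent d) * pairProd univ fun i j => xvar i - xvar j := by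
  simp only [map_pairProd, map_sub, permVars_xvar]
  rw [pairProd_univ_sub_comp_perm xvar σ.symm, Equiv.Perm.sign_symm]

lemma isAlternating_constTerm_mul :
    IsAlternating (constTerm ∘ₗ LinearMap.mulLeft ℚ
      ((∏ i : Fin d, xvar i) * pairProd univ fun i j => xvar i - xvar j)) := by
  intro σ p
  simp only [LinearMap.comp_apply, LinearMap.mulLeft_apply]
  set X := ∏ i : Fin d, (xvar i : MvLaurent d) with hX
  set D := pairProd univ fun i j : Fin d => xvar i - xvar j with hD
  have h1 : permVars σ X = X := by
    simp only [hX, xvar_eq_subst, permVars_prod_subst]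
  have h2 := permVars_pairProd_xvar (d := d) σ
  rw [← hD] at h2
  have h3 : X * D * permVars σ p =
      permVars σ (((Equiv.Perm.sign σ : ℤ) : MvLaurent d) * (X * D * p)) := by
    rw [map_mul, map_mul, map_mul, h1, h2, map_intCast]
    rcases Int.units_eq_one_or (Equiv.Perm.sign σ) with h | h <;> simp [h]
  rw [h3, constTerm_permVars]
  rcases Int.units_eq_one_or (Equiv.Perm.sign σ) with h | h <;> simp [h]

/-- In the expansion of the determinant, each term is a permutation of the diagonal one; its sign
cancels the sign from `L`. Used in both directions, so that `d!` cancels. -/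
lemma IsAlternating.map_det_mul {L : MvLaurent d →ₗ[ℚ] ℚ} (hL : IsAlternating L)
    (u : Fin d → LaurentPolynomial ℚ) {f : MvLaurent d} (hf : ∀ σ, permVars σ f = f) :
    L ((Matrix.of fun i j => subst i (u j)).det * f) =
      d.factorial * L ((∏ i, subst i (u i)) * f) := by
  rw [Matrix.det_apply', sum_mul, map_sum]
  have h : ∀ σ : Equiv.Perm (Fin d),
      L (((Equiv.Perm.sign σ : ℤ) : MvLaurent d) *
        (∏ i, Matrix.of (fun i j => subst i (u j)) (σ i) i) * f) =
        L ((∏ i, subst i (u i)) * f) := by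
    intro σ
    have e : (∏ i, Matrix.of (fun i j => subst i (u j)) (σ i) i) * f =
        permVars σ.symm ((∏ i, subst i (u i)) * f) := by
      rw [map_mul, hf, map_prod]
      simp [permVars_subst]
    have hz : ∀ (n : ℤ) (p : MvLaurent d), L ((n : MvLaurent d) * p) = n * L p := fun n p => by
      rw [← zsmul_eq_mul, map_zsmul, zsmul_eq_mul]
    rw [mul_assoc, e, hz, hL, Equiv.Perm.sign_symm, ← mul_assoc]
    rcases Int.units_eq_one_or (Equiv.Perm.sign σ) with h | h <;> simp [h]
  rw [sum_congr rfl fun σ _ => h σ, sum_const, card_univ, Fintype.card_perm, Fintype.card_fin,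
    nsmul_eq_mul]

/-- The Weyl denominator formula of type `C`. -/
lemma det_subst_T_sub (d : ℕ) :
    (Matrix.of fun i j : Fin d => subst i (T ((d : ℤ) - j) - T (-((d : ℤ) - j)))).det =
      littlewoodDenom univ * ((∏ i, subst i (1 + T 1)) *
        pairProd univ fun i j => subst i (T 1) - subst j (T 1)) := by
  have h : (Matrix.of fun i j : Fin d => subst i (T ((d : ℤ) - j) - T (-((d : ℤ) - j)))) =
      Matrix.of fun i j : Fin d => subst i (T 1 - T (-1)) *
        (Matrix.of fun i j : Fin d => (Polynomial.Chebyshev.S (MvLaurent d)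
          (d - 1 - j : ℕ)).eval (subst i (T 1 + T (-1)))) i j := by
    ext1 i j
    have e : (d : ℤ) - j = ((d - 1 - j : ℕ) : ℤ) + 1 := by omega
    simp only [Matrix.of_apply]
    rw [e, laurentT_sub_eq_mul_eval_chebyshevS, map_mul]
    congr 1
    have := Polynomial.hom_eval₂ (Polynomial.Chebyshev.S (LaurentPolynomial ℚ) (d - 1 - j : ℕ))
      (RingHom.id _) (subst i : LaurentPolynomial ℚ →+* MvLaurent d) (T 1 + T (-1))
    rw [← Polynomial.Chebyshev.map_S (subst i : LaurentPolynomial ℚ →+* MvLaurent d),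
      Polynomial.eval_map]
    exact this
  have hzx : ∀ i : Fin d, subst i (T 1) * xvar i = 1 := fun i => by
    rw [xvar_eq_subst, ← map_mul, ← LaurentPolynomial.T_add]
    simp
  rw [h, Matrix.det_mul_column, det_eval_chebyshevS, littlewoodDenom]
  -- The factor `1 + z` in the definition of `J` originates here.
  have h1 : ∀ i : Fin d, subst i (T 1 - T (-1)) = (1 - xvar i) * subst i (1 + T 1) := by
    intro i
    have := hzx i
    simp only [map_sub, map_add, map_one, ← xvar_eq_subst]
    linear_combination this
  have h2 : ∀ i j : Fin d, subst i (T 1 + T (-1)) - subst j (T 1 + T (-1)) =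
      (1 - xvar i * xvar j) * (subst i (T 1) - subst j (T 1)) := by
    intro i j
    have hi := hzx i
    have hj := hzx j
    simp only [map_add, ← xvar_eq_subst]
    linear_combination xvar j * hi - xvar i * hj
  simp only [h1, h2, prod_mul_distrib, pairProd_mul]
  ring

/-- Antisymmetrize, apply Littlewood's identity, then undo the antisymmetrization on the Vandermonde
product in `z`. The one in `x` stays a determinant. -/
theorem functional_sortSign_prod_mul_eq_constTerm_det_mul {f : MvLaurent d}
    (hf : ∀ σ, permVars σ f = f) :
    functional (sortSign univ)
        ((∏ i : Fin d, subst i (T ((d : ℤ) - i) - T (-((d : ℤ) - i)))) * f) =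
      constTerm ((Matrix.of fun i j : Fin d =>
        subst i (T ((j : ℤ) - i - 1) * (1 + T 1))).det * f) := by
  have hd : (d.factorial : ℚ) ≠ 0 := by exact_mod_cast d.factorial_ne_zero
  apply mul_left_cancel₀ hd
  rw [← isAlternating_functional_sortSign.map_det_mul
    (fun j : Fin d => T ((d : ℤ) - j) - T (-((d : ℤ) - j))) hf, det_subst_T_sub, mul_assoc,
    functional_sortSign_littlewoodDenom_mul]
  have hg : ∀ σ, permVars σ ((∏ i, subst i (1 + T 1)) * f) = (∏ i, subst i (1 + T 1)) * f :=
    fun σ => by rw [map_mul, hf, permVars_prod_subst]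
  have h1 := isAlternating_constTerm_mul.map_det_mul
    (fun j : Fin d => T (((d - 1 - j : ℕ) : ℤ))) hg
  have h2 : (pairProd univ fun i j : Fin d => subst i (T 1) - subst j (T 1)) =
      (Matrix.of fun i j : Fin d => subst i (T (((d - 1 - j : ℕ) : ℤ)))).det := by
    rw [pairProd_univ_sub fun i : Fin d => subst i (T 1)]
    congr 1
    ext1 i j
    simp only [Matrix.of_apply]
    rw [← map_pow, LaurentPolynomial.T_pow, mul_one]
  rw [h2]
  simp only [LinearMap.comp_apply, LinearMap.mulLeft_apply] at h1
  rw [mul_comm (∏ i, subst i (1 + T 1)), mul_assoc (Matrix.det _), h1]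
  congr 2
  rw [pairProd_univ_sub]
  -- The exponents add up as `-1 + (d - 1 - i) - (d - 1 - j) = j - i - 1`.
  have h3 : (Matrix.of fun i j : Fin d => subst i (T ((j : ℤ) - i - 1) * (1 + T 1))) =
      Matrix.of fun i j : Fin d => (xvar i * subst i (T (((d - 1 - i : ℕ) : ℤ))) *
        subst i (1 + T 1)) * (Matrix.of fun i j : Fin d => xvar i ^ (d - 1 - (j : ℕ))) i j := by
    ext1 i j
    simp only [Matrix.of_apply]
    rw [xvar_eq_subst, ← map_pow, LaurentPolynomial.T_pow, ← map_mul, ← map_mul, ← map_mul,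
      mul_right_comm, ← LaurentPolynomial.T_add, ← LaurentPolynomial.T_add]
    congr 3
    omega
  rw [h3, Matrix.det_mul_column, prod_mul_distrib, prod_mul_distrib]
  ring

end MvLaurent

/-! ### Bessel series as coefficients of the exponential kernel -/

section Bessel

open LaurentPolynomial (T)

lemma LaurentPolynomial.coeff_T_mul (n s : ℤ) (f : LaurentPolynomial ℚ) :
    (T n * f).coeff s = f.coeff (s - n) := by
  rw [T, AddMonoidAlgebra.coeff_single_mul_apply, one_mul, neg_add_eq_sub]

lemma coeff_expKernel (n : ℕ) :
    PowerSeries.coeff n expKernel =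
      (1 / (n.factorial : ℚ)) • (T 1 + T (-1) : LaurentPolynomial ℚ) ^ n := by
  rw [expKernel, PowerSeries.coeff_rescale, PowerSeries.coeff_exp, Algebra.smul_def, mul_comm]

lemma besselI_eq_zCoeff (s : ℤ) : besselI s = zCoeff s expKernel := by
  ext m
  rw [besselI, zCoeff, PowerSeries.coeff_mk, PowerSeries.coeff_mk, coeff_expKernel,
    add_comm (T 1), add_pow, AddMonoidAlgebra.coeff_smul, AddMonoidAlgebra.coeff_sum, Finsupp.smul_apply,
    Finsupp.finsetSum_apply, smul_eq_mul, mul_sum]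
  refine sum_congr rfl fun n hn => ?_
  have hnm : n ≤ m := Nat.lt_succ_iff.1 (mem_range.1 hn)
  have e : (T (-1) ^ n * T 1 ^ (m - n) * (m.choose n : LaurentPolynomial ℚ)) =
      (m.choose n : ℚ) • T ((m : ℤ) - 2 * n) := by
    rw [LaurentPolynomial.T_pow, LaurentPolynomial.T_pow, ← LaurentPolynomial.T_add,
      Algebra.smul_def, mul_comm, map_natCast]
    congr 2
    push_cast [hnm]
    ring
  rw [e, AddMonoidAlgebra.coeff_smul, Finsupp.smul_apply, LaurentPolynomial.T_apply, smul_eq_mul]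
  by_cases h : (m : ℤ) = 2 * n + s
  · have h1 : (((n : ℤ) + s).toNat) = m - n := by omega
    rw [if_pos ⟨by omega, h⟩, if_pos (by omega), h1, Nat.cast_choose ℚ hnm]
    have := Nat.factorial_ne_zero m
    field_simp
  · rw [if_neg (fun h' => h h'.2), if_neg (by omega), mul_zero, mul_zero]

lemma besselJ_eq_zCoeff (s : ℤ) :
    besselJ s = zCoeff s (PowerSeries.C (1 + T 1) * expKernel) := by
  rw [besselJ, besselI_eq_zCoeff, besselI_eq_zCoeff]
  ext m
  simp only [zCoeff, PowerSeries.coeff_mk, PowerSeries.coeff_C_mul, map_add (PowerSeries.coeff m)]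
  rw [add_mul, one_mul, AddMonoidAlgebra.coeff_add, Finsupp.add_apply,
    LaurentPolynomial.coeff_T_mul]

lemma besselI_neg (s : ℤ) : besselI (-s) = besselI s := by
  rw [besselI_eq_zCoeff, besselI_eq_zCoeff]
  ext m
  rw [zCoeff, zCoeff, PowerSeries.coeff_mk, PowerSeries.coeff_mk, ← LaurentPolynomial.invert_apply,
    coeff_expKernel, map_smul, map_pow, map_add, LaurentPolynomial.invert_T,
    LaurentPolynomial.invert_T, neg_neg, add_comm]

/-- The symmetry `z ↦ z⁻¹` of the kernel; it converts the index `1 - s` produced by a constant term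
into `s`. -/
lemma besselJ_one_sub (s : ℤ) : besselJ (1 - s) = besselJ s := by
  rw [besselJ, besselJ, ← besselI_neg (1 - s), ← besselI_neg (1 - s - 1), add_comm]
  congr 2 <;> ring

lemma zCoeff_zero_C_T_mul (s : ℤ) :
    zCoeff 0 (PowerSeries.C (T (s - 1) * (1 + T 1)) * expKernel) = besselJ s := by
  rw [← besselJ_one_sub, besselJ_eq_zCoeff]
  ext m
  simp only [zCoeff, PowerSeries.coeff_mk, PowerSeries.coeff_C_mul]
  rw [mul_assoc, LaurentPolynomial.coeff_T_mul]
  congr 1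
  ring

end Bessel

/-! ### Constant terms in separated variables -/

namespace MvLaurent

variable {d : ℕ}

open LaurentPolynomial (T)

lemma constTerm_prod_subst (g : Fin d → LaurentPolynomial ℚ) :
    constTerm (∏ i, subst i (g i)) = ∏ i, (g i).coeff 0 := by
  classical
  have hg : ∀ i, subst i (g i) =
      ∑ k ∈ (g i).coeff.support, (g i).coeff k • mono (Pi.single i k) := by
    intro i
    have : g i = ∑ k ∈ (g i).coeff.support, (g i).coeff k • T k := by
      ext n
      simp [Finsupp.finsetSum_apply]
    conv_lhs => rw [this]
    simp only [map_sum, map_smul, subst_T]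
  have hκ : ∀ κ : Fin d → ℤ, ∏ i, (g i).coeff (κ i) • mono (Pi.single i (κ i)) =
      (∏ i, (g i).coeff (κ i)) • mono κ := by
    intro κ
    rw [prod_smul, ← mono_sum, univ_sum_single]
  simp only [hg]
  rw [prod_univ_sum, map_sum]
  simp only [hκ, map_smul, constTerm, functional_mono, smul_eq_mul, mul_ite, mul_one, mul_zero]
  rw [sum_ite_eq']
  split_ifs with h
  · rfl
  · rw [Fintype.mem_piFinset] at h
    push Not at h
    obtain ⟨i, hi⟩ := h
    exact (prod_eq_zero (mem_univ i) (by simpa using hi)).symm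

lemma coeff_prod_zCoeff (G : Fin d → PowerSeries (LaurentPolynomial ℚ)) (n : ℕ) :
    PowerSeries.coeff n (∏ i, zCoeff 0 (G i)) =
      constTerm (PowerSeries.coeff n
        (∏ i, PowerSeries.map (subst i : LaurentPolynomial ℚ →+* MvLaurent d) (G i))) := by
  rw [PowerSeries.coeff_prod, PowerSeries.coeff_prod, map_sum]
  refine sum_congr rfl fun l _ => ?_
  simp only [PowerSeries.coeff_map, RingHom.coe_coe, constTerm_prod_subst, zCoeff,
    PowerSeries.coeff_mk]

lemma prod_rescale_exp (s : Finset (Fin d)) (w : Fin d → MvLaurent d) :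
    ∏ i ∈ s, PowerSeries.rescale (w i) (PowerSeries.exp (MvLaurent d)) =
      PowerSeries.rescale (∑ i ∈ s, w i) (PowerSeries.exp (MvLaurent d)) := by
  induction s using Finset.induction_on with
  | empty => simp
  | insert k s hk ih => rw [prod_insert hk, sum_insert hk, ih, PowerSeries.exp_mul_exp_eq_exp_add]

lemma coeff_prod_zCoeff_C_mul_expKernel (u : Fin d → LaurentPolynomial ℚ) (n : ℕ) :
    n.factorial * PowerSeries.coeff n (∏ i, zCoeff 0 (PowerSeries.C (u i) * expKernel)) =
      constTerm ((∏ i, subst i (u i)) * (∑ i, subst i (T 1 + T (-1))) ^ n) := by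
  have h : ∀ i, PowerSeries.map (subst i : LaurentPolynomial ℚ →+* MvLaurent d)
      (PowerSeries.C (u i) * expKernel) = PowerSeries.C (subst i (u i)) *
        PowerSeries.rescale (subst i (T 1 + T (-1))) (PowerSeries.exp (MvLaurent d)) := by
    intro i
    rw [map_mul, PowerSeries.map_C]
    congr 1
    ext1 m
    rw [PowerSeries.coeff_map, coeff_expKernel, PowerSeries.coeff_rescale, PowerSeries.coeff_exp,
      RingHom.coe_coe, map_smul, map_pow, Algebra.smul_def, mul_comm]
  rw [coeff_prod_zCoeff, prod_congr rfl fun i _ => h i, prod_mul_distrib, prod_rescale_exp,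
    ← map_prod, PowerSeries.coeff_C_mul, PowerSeries.coeff_rescale, PowerSeries.coeff_exp,
    mul_comm (_ ^ n), mul_left_comm, ← Algebra.smul_def, map_smul, smul_eq_mul, ← mul_assoc]
  have : (n.factorial : ℚ) ≠ 0 := by exact_mod_cast n.factorial_ne_zero
  rw [mul_one_div_cancel this, one_mul]

/-- Each term of the determinant uses every variable exactly once, so its constant term factors.
Transposing attaches the variable `z_i` to the factor indexed by `i`. -/
lemma factorial_mul_coeff_det_besselJ (d n : ℕ) :
    n.factorial * PowerSeries.coeff n
        (Matrix.of fun i j : Fin d => besselJ ((i : ℤ) - (j : ℤ))).det =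
      constTerm ((Matrix.of fun i j : Fin d =>
        subst i (T ((j : ℤ) - i - 1) * (1 + T 1))).det * (∑ i, subst i (T 1 + T (-1))) ^ n) := by
  rw [← Matrix.det_transpose (Matrix.of fun i j : Fin d => subst i _), Matrix.det_apply',
    Matrix.det_apply', map_sum, sum_mul, map_sum, mul_sum]
  refine sum_congr rfl fun σ _ => ?_
  have h := coeff_prod_zCoeff_C_mul_expKernel
    (fun i : Fin d => T (((σ i : Fin d) : ℤ) - i - 1) * (1 + T 1)) n
  simp only [zCoeff_zero_C_T_mul] at h
  simp only [Matrix.of_apply, Matrix.transpose_apply]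
  rcases Int.units_eq_one_or (Equiv.Perm.sign σ) with hσ | hσ <;> simp [hσ, h]

end MvLaurent

/-! ### The reflection principle -/

namespace MvLaurent

variable {d : ℕ}

open LaurentPolynomial (T)

/-- The symmetric Laurent polynomial `∑ (z_i + z_i⁻¹)`. -/
noncomputable def stepSum (d : ℕ) : MvLaurent d := ∑ i, subst i (T 1 + T (-1))

/-- `∏ (z_i ^ a_i - z_i ^ (-a_i))` -/
noncomputable def signedOrbit (a : Fin d → ℤ) : MvLaurent d :=
  ∏ i, subst i (T (a i) - T (-a i))

/-- The number of walks starting at `a`, counted with signs by the reflection principle. -/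
noncomputable def reflectedCount (a : Fin d → ℤ) (n : ℕ) : ℚ :=
  functional (sortSign univ) (signedOrbit a * stepSum d ^ n)

lemma signedOrbit_mul_stepSum (a : Fin d → ℤ) :
    signedOrbit a * stepSum d =
      ∑ i, (signedOrbit (a + Pi.single i 1) + signedOrbit (a - Pi.single i 1)) := by
  rw [stepSum, mul_sum]
  refine sum_congr rfl fun i _ => ?_
  have hout : ∀ (c : ℤ), ∏ j ∈ univ.erase i, subst j (T ((a + Pi.single i c : Fin d → ℤ) j) -
      T (-(a + Pi.single i c : Fin d → ℤ) j)) = ∏ j ∈ univ.erase i, subst j (T (a j) - T (-a j)) := by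
    intro c
    refine prod_congr rfl fun j hj => ?_
    rw [Pi.add_apply, Pi.single_eq_of_ne (ne_of_mem_erase hj), add_zero]
  have hsub : a - Pi.single i 1 = a + Pi.single i (-1) := by rw [Pi.single_neg, sub_eq_add_neg]
  rw [hsub, signedOrbit, signedOrbit, signedOrbit, ← mul_prod_erase univ _ (mem_univ i),
    ← mul_prod_erase univ _ (mem_univ i), ← mul_prod_erase univ _ (mem_univ i), hout, hout,
    ← add_mul, mul_right_comm, ← map_mul, ← map_add]
  congr 2
  simp only [Pi.add_apply, Pi.single_eq_same, sub_mul, mul_add, ← LaurentPolynomial.T_add, neg_add,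
    neg_neg]
  ring

lemma reflectedCount_succ (a : Fin d → ℤ) (n : ℕ) :
    reflectedCount a (n + 1) =
      ∑ i, (reflectedCount (a + Pi.single i 1) n + reflectedCount (a - Pi.single i 1) n) := by
  simp only [reflectedCount]
  rw [pow_succ', ← mul_assoc, signedOrbit_mul_stepSum, sum_mul, map_sum]
  simp only [add_mul, map_add]

lemma reflectedCount_eq_zero_of_eq_zero {a : Fin d → ℤ} {i : Fin d} (h : a i = 0) (n : ℕ) :
    reflectedCount a n = 0 := by
  rw [reflectedCount, signedOrbit, prod_eq_zero (mem_univ i) (by simp [h]), zero_mul, map_zero]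

lemma permVars_stepSum_pow (σ : Equiv.Perm (Fin d)) (n : ℕ) :
    permVars σ (stepSum d ^ n) = stepSum d ^ n := by
  rw [map_pow, stepSum, permVars_sum_subst]

/-- Swapping `z_i` and `z_j` fixes the argument but negates the functional. -/
lemma reflectedCount_eq_zero_of_eq {a : Fin d → ℤ} {i j : Fin d} (hij : i ≠ j) (h : a i = a j)
    (n : ℕ) : reflectedCount a n = 0 := by
  have hσ : ∀ k, a (Equiv.swap i j k) = a k := by
    intro k
    rw [Equiv.swap_apply_def]
    split_ifs with h1 h2
    · rw [h1, h]
    · rw [h2, h]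
    · rfl
  have h1 : permVars (Equiv.swap i j) (signedOrbit a * stepSum d ^ n) =
      signedOrbit a * stepSum d ^ n := by
    rw [map_mul, permVars_stepSum_pow, signedOrbit, map_prod]
    congr 1
    simp only [permVars_subst, Equiv.symm_swap]
    rw [← Equiv.prod_comp (Equiv.swap i j) fun k => subst k (T (a k) - T (-a k))]
    simp only [hσ]
  have h2 := isAlternating_functional_sortSign (Equiv.swap i j) (signedOrbit a * stepSum d ^ n)
  rw [h1, Equiv.Perm.sign_swap hij, ← reflectedCount] at h2
  norm_num at h2
  linarith

lemma reflectedCount_zero {a : Fin d → ℤ} (ha : a ∈ weylChamber d) : reflectedCount a 0 = 1 := by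
  rw [reflectedCount, pow_zero, mul_one, signedOrbit]
  simp only [map_sub, subst_T]
  -- Expand over the set of coordinates whose sign is flipped; a nonempty set yields a negative
  -- exponent, where `sortSign` is zero.
  rw [prod_sub, map_sum, sum_eq_single_of_mem ∅ (empty_mem_powerset _)]
  · have h : ∏ i, mono (Pi.single i (a i)) = mono a := by rw [← mono_sum, univ_sum_single]
    simp only [card_empty, pow_zero, sdiff_empty, prod_empty, one_mul, mul_one, h, functional_mono]
    rw [sortSign, if_pos fun i => ⟨fun _ => ha.2 i, fun h => absurd (mem_univ i) h⟩]
    refine prod_eq_one fun i _ => prod_eq_one fun j _ => ?_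
    split_ifs with hij
    · beta_reduce
      rw [Int.sign_eq_one_of_pos (sub_pos.2 (ha.1 hij)), Int.cast_one]
    · rfl
  · intro t _ ht
    obtain ⟨i, hi⟩ := nonempty_iff_ne_empty.2 ht
    have hz : ∀ p : MvLaurent d, functional (sortSign univ) p = 0 →
        functional (sortSign univ) ((-1) ^ #t * p) = 0 := by
      intro p hp
      rcases neg_one_pow_eq_or (MvLaurent d) #t with h | h <;> simp [h, hp]
    rw [mul_assoc]
    apply hz
    rw [← mono_sum, ← mono_sum, ← mono_add, functional_mono]
    refine sortSign_eq_zero (mem_univ i) ?_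
    have := ha.2 i
    simp [Finset.sum_apply, Pi.single_apply, hi]
    omega

end MvLaurent

/-! ### Counting walks in the Weyl chamber -/

section Walks

open MvLaurent

variable {d : ℕ}

/-- The step `e_i` or `-e_i`. -/
def stepVec (p : Fin d × Bool) : Fin d → ℤ := if p.2 then Pi.single p.1 1 else -Pi.single p.1 1

lemma stepVec_injective : Function.Injective (stepVec : Fin d × Bool → Fin d → ℤ) := by
  rintro ⟨i, b⟩ ⟨j, c⟩ h
  have hi := congrFun h i
  by_cases hij : i = j
  · subst hij
    cases b <;> cases c <;> simp [stepVec] at hi ⊢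
  · cases b <;> cases c <;> simp [stepVec, hij] at hi

lemma exists_step_iff (a b : Fin d → ℤ) :
    (∃ i : Fin d, b = a + Pi.single i 1 ∨ b = a - Pi.single i 1) ↔ ∃ p, b = a + stepVec p := by
  constructor
  · rintro ⟨i, h | h⟩
    · exact ⟨(i, true), by simpa [stepVec] using h⟩
    · exact ⟨(i, false), by simpa [stepVec, sub_eq_add_neg] using h⟩
  · rintro ⟨⟨i, b⟩, h⟩
    cases b
    · exact ⟨i, Or.inr (by simpa [stepVec, sub_eq_add_neg] using h)⟩
    · exact ⟨i, Or.inl (by simpa [stepVec] using h)⟩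

/-- A unit step changes one coordinate by one, so it cannot jump over a wall: on leaving the chamber
it lands where a coordinate is zero or two coordinates agree. -/
lemma reflectedCount_add_stepVec_of_notMem {a : Fin d → ℤ} (ha : a ∈ weylChamber d)
    {p : Fin d × Bool} (hp : a + stepVec p ∉ weylChamber d) (n : ℕ) :
    reflectedCount (a + stepVec p) n = 0 := by
  by_contra hne
  apply hp
  have h0 : ∀ i, (a + stepVec p) i ≠ 0 := fun i h =>
    hne (reflectedCount_eq_zero_of_eq_zero h n)
  have h1 : ∀ i j, i ≠ j → (a + stepVec p) i ≠ (a + stepVec p) j := fun i j hij h =>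
    hne (reflectedCount_eq_zero_of_eq hij h n)
  have hs : ∀ i, stepVec p i = if i = p.1 then (if p.2 then 1 else -1) else 0 := by
    intro i
    rw [stepVec]
    split_ifs with h h' h' <;> simp [h']
  refine ⟨fun i j hij => ?_, fun i => ?_⟩
  · have h2 := ha.1 hij
    have h3 := h1 i j hij.ne
    simp only [Pi.add_apply, hs] at h3 ⊢
    have h4 : ¬ (i = p.1 ∧ j = p.1) := fun h => hij.ne (h.1.trans h.2.symm)
    split_ifs at h3 ⊢ <;> omega
  · have h2 := ha.2 i
    have h3 := h0 i
    simp only [Pi.add_apply, hs] at h3 ⊢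
    split_ifs at h3 ⊢ <;> omega

/-- The walks of length `n` in the Weyl chamber that start at `a`. -/
def walksFrom (d n : ℕ) (a : Fin d → ℤ) : Set (Fin (n + 1) → Fin d → ℤ) :=
  {w | w 0 = a ∧ (∀ k, w k ∈ weylChamber d) ∧
    ∀ k : Fin n, ∃ i : Fin d,
      w k.succ = w k.castSucc + Pi.single i 1 ∨ w k.succ = w k.castSucc - Pi.single i 1}

lemma cons_mem_walksFrom {n : ℕ} {a x : Fin d → ℤ} {w : Fin (n + 1) → Fin d → ℤ} :
    (Fin.cons x w : Fin (n + 2) → Fin d → ℤ) ∈ walksFrom d (n + 1) a ↔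
      x = a ∧ a ∈ weylChamber d ∧ ∃ p, w ∈ walksFrom d n (a + stepVec p) := by
  simp only [walksFrom, Set.mem_ofPred_eq, exists_step_iff, Fin.forall_fin_succ (n := n),
    Fin.forall_fin_succ (n := n + 1), Fin.cons_zero, Fin.cons_succ, Fin.castSucc_zero,
    ← Fin.succ_castSucc]
  constructor
  · rintro ⟨rfl, ⟨h1, h2⟩, ⟨p, hp⟩, h3⟩
    exact ⟨rfl, h1, p, hp, h2, h3⟩
  · rintro ⟨rfl, h1, p, hp, h2, h3⟩
    exact ⟨rfl, ⟨h1, h2⟩, ⟨p, hp⟩, h3⟩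

/-- Finiteness and the count come from one induction on the first step. Steps that leave the chamber
contribute zero on both sides. -/
lemma exists_finset_eq_walksFrom (n : ℕ) (a : Fin d → ℤ) :
    ∃ F : Finset (Fin (n + 1) → Fin d → ℤ), (F : Set (Fin (n + 1) → Fin d → ℤ)) = walksFrom d n a ∧
      (a ∈ weylChamber d → (#F : ℚ) = reflectedCount a n) := by
  classical
  induction n generalizing a with
  | zero =>
    by_cases ha : a ∈ weylChamber d
    · refine ⟨{fun _ => a}, ?_, fun _ => by simp [reflectedCount_zero ha]⟩
      ext w
      simp only [coe_singleton, Set.mem_singleton_iff, walksFrom, Set.mem_ofPred_eq]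
      constructor
      · rintro rfl
        exact ⟨rfl, fun _ => ha, fun k => k.elim0⟩
      · rintro ⟨h, -, -⟩
        ext1 k
        rw [Fin.fin_one_eq_zero k, h]
    · refine ⟨∅, ?_, fun h => absurd h ha⟩
      ext w
      simp only [coe_empty, Set.mem_empty_iff_false, false_iff]
      rintro ⟨h, h', -⟩
      exact ha (h ▸ h' 0)
  | succ n ih =>
    choose F hF hcard using ih
    by_cases ha : a ∈ weylChamber d
    · have hmem : ∀ b w, w ∈ F b ↔ w ∈ walksFrom d n b := fun b w => by rw [← hF b, mem_coe]
      refine ⟨univ.biUnion fun p => (F (a + stepVec p)).image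
        (Fin.cons (α := fun _ => Fin d → ℤ) a), ?_, fun _ => ?_⟩
      · ext w
        rw [← Fin.cons_self_tail w, cons_mem_walksFrom]
        simp only [coe_biUnion, coe_univ, Set.mem_univ, Set.iUnion_true, Set.mem_iUnion, mem_coe,
          mem_image, hmem, Fin.cons_inj]
        constructor
        · rintro ⟨p, v, hv, h, rfl⟩
          exact ⟨h.symm, ha, p, hv⟩
        · rintro ⟨h, -, p, hp⟩
          exact ⟨p, _, hp, h.symm, rfl⟩
      · rw [card_biUnion]
        · have h1 : ∀ p, ((#((F (a + stepVec p)).image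
              (Fin.cons (α := fun _ => Fin d → ℤ) a)) : ℕ) : ℚ) =
              reflectedCount (a + stepVec p) n := by
            intro p
            rw [card_image_of_injective _ (Fin.cons_right_injective (α := fun _ => Fin d → ℤ) a)]
            by_cases hp : a + stepVec p ∈ weylChamber d
            · exact hcard _ hp
            · rw [reflectedCount_add_stepVec_of_notMem ha hp]
              have : F (a + stepVec p) = ∅ := by
                ext w
                simp only [hmem, notMem_empty, iff_false]
                rintro ⟨h, h', -⟩
                exact hp (h ▸ h' 0)
              simp [this]
          rw [Nat.cast_sum, sum_congr rfl fun p _ => h1 p, Fintype.sum_prod_type,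
            reflectedCount_succ]
          refine sum_congr rfl fun i _ => ?_
          rw [Fintype.sum_bool]
          simp [stepVec, sub_eq_add_neg]
        · intro p _ q _ hpq
          rw [Function.onFun, disjoint_left]
          simp only [mem_image, hmem]
          rintro w ⟨v, hv, rfl⟩ ⟨v', hv', h⟩
          have : v' = v := Fin.cons_right_injective (α := fun _ => Fin d → ℤ) a h
          subst this
          exact hpq (stepVec_injective (add_left_cancel (hv.1.symm.trans hv'.1)))
    · refine ⟨∅, ?_, fun h => absurd h ha⟩
      ext w
      simp only [coe_empty, Set.mem_empty_iff_false, false_iff]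
      rintro ⟨h, h', -⟩
      exact ha (h ▸ h' 0)

lemma finite_walksFrom (n : ℕ) (a : Fin d → ℤ) : (walksFrom d n a).Finite := by
  obtain ⟨F, hF, -⟩ := exists_finset_eq_walksFrom n a
  exact hF ▸ F.finite_toSet

lemma ncard_walksFrom (n : ℕ) {a : Fin d → ℤ} (ha : a ∈ weylChamber d) :
    ((walksFrom d n a).ncard : ℚ) = reflectedCount a n := by
  obtain ⟨F, hF, h⟩ := exists_finset_eq_walksFrom n a
  rw [← hF, Set.ncard_coe_finset, h ha]

lemma weylWalks_eq (n : ℕ) (a b : Fin d → ℤ) :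
    weylWalks d n a b = {w ∈ walksFrom d n a | w (Fin.last n) = b} := by
  ext w
  simp only [weylWalks, walksFrom, Set.mem_ofPred_eq]
  tauto

lemma finite_weylWalks (n : ℕ) (a b : Fin d → ℤ) : (weylWalks d n a b).Finite := by
  rw [weylWalks_eq]
  exact (finite_walksFrom n a).subset (Set.sep_subset _ _)

lemma weylWalkCount_ne_zero_iff (n : ℕ) (a b : Fin d → ℤ) :
    weylWalkCount d n a b ≠ 0 ↔ ∃ w ∈ walksFrom d n a, w (Fin.last n) = b := by
  rw [weylWalkCount, ← Nat.pos_iff_ne_zero, Set.ncard_pos (finite_weylWalks n a b), weylWalks_eq]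
  rfl

lemma finite_setOf_weylWalkCount_ne_zero (n : ℕ) (a : Fin d → ℤ) :
    {b ∈ weylChamber d | weylWalkCount d n a b ≠ 0}.Finite := by
  refine ((finite_walksFrom n a).image fun w => w (Fin.last n)).subset ?_
  rintro b ⟨-, hb⟩
  exact (weylWalkCount_ne_zero_iff n a b).1 hb

lemma finsum_weylWalkCount (n : ℕ) (a : Fin d → ℤ) :
    ∑ᶠ b ∈ weylChamber d, weylWalkCount d n a b = (walksFrom d n a).ncard := by
  classical
  obtain ⟨F, hF, -⟩ := exists_finset_eq_walksFrom n a
  have hmem : ∀ w, w ∈ F ↔ w ∈ walksFrom d n a := fun w => by rw [← hF, mem_coe]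
  have hcount : ∀ b, weylWalkCount d n a b = #{w ∈ F | w (Fin.last n) = b} := by
    intro b
    rw [weylWalkCount, weylWalks_eq, ← Set.ncard_coe_finset]
    congr 1
    ext w
    simp [hmem]
  -- A `finsum` of infinite support would be `0`; here the support in the chamber lies in the finite
  -- set of end points.
  rw [finsum_mem_eq_sum_of_inter_support_eq (t := F.image fun w => w (Fin.last n)), ← hF,
    Set.ncard_coe_finset, card_eq_sum_card_image (fun w => w (Fin.last n)) F]
  · exact sum_congr rfl fun b _ => hcount b
  · ext b
    simp only [Set.mem_inter_iff, Function.mem_support, and_congr_left_iff]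
    intro hb
    obtain ⟨w, hw, rfl⟩ := (weylWalkCount_ne_zero_iff n a b).1 hb
    exact ⟨fun _ => mem_coe.2 (mem_image_of_mem _ ((hmem w).2 hw)), fun _ => hw.2.1 _⟩

end Walks

/-! ### Oscillating tableaux as walks -/

section Tableaux

/-- The vector `(μ_1 + d, …, μ_d + 1)` of shifted row lengths. -/
def shiftedRows (d : ℕ) (μ : YoungDiagram) : Fin d → ℤ := fun i => μ.rowLen i + ((d : ℤ) - i)

lemma YoungDiagram.ext_rowLen {μ ν : YoungDiagram} (h : ∀ i, μ.rowLen i = ν.rowLen i) : μ = ν := by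
  ext ⟨i, j⟩
  rw [YoungDiagram.mem_cells, YoungDiagram.mem_cells, YoungDiagram.mem_iff_lt_rowLen,
    YoungDiagram.mem_iff_lt_rowLen, h]

lemma YoungDiagram.rowLen_eq_zero {μ : YoungDiagram} {d i : ℕ} (h : μ.colLen 0 ≤ d) (hi : d ≤ i) :
    μ.rowLen i = 0 := by
  by_contra hne
  have : (i, 0) ∈ μ := YoungDiagram.mem_iff_lt_rowLen.2 (Nat.pos_of_ne_zero hne)
  have := YoungDiagram.mem_iff_lt_colLen.1 this
  omega

lemma addsSquare_iff_rowLen (μ ν : YoungDiagram) :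
    AddsSquare μ ν ↔ ∃ i, ∀ j, ν.rowLen j = μ.rowLen j + if j = i then 1 else 0 := by
  constructor
  · rintro ⟨⟨i, m⟩, hm, hν⟩
    have hmem : ∀ j k, k < ν.rowLen j ↔ (j = i ∧ k = m) ∨ k < μ.rowLen j := by
      intro j k
      rw [← YoungDiagram.mem_iff_lt_rowLen, ← YoungDiagram.mem_iff_lt_rowLen,
        ← YoungDiagram.mem_cells, hν, mem_insert, Prod.mk_inj, YoungDiagram.mem_cells]
    rw [YoungDiagram.mem_cells, YoungDiagram.mem_iff_lt_rowLen] at hm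
    refine ⟨i, fun j => ?_⟩
    split_ifs with hj
    · subst hj
      -- Rows are initial segments, so these three columns force `m = μ.rowLen j`.
      have h1 := hmem j m
      have h2 := hmem j (μ.rowLen j)
      have h3 := hmem j (m + 1)
      omega
    · have h1 := hmem j (μ.rowLen j)
      have h2 := hmem j (ν.rowLen j)
      omega
  · rintro ⟨i, h⟩
    refine ⟨(i, μ.rowLen i), ?_, ?_⟩
    · rw [YoungDiagram.mem_cells, YoungDiagram.mem_iff_lt_rowLen]
      exact lt_irrefl _
    · ext ⟨j, k⟩
      rw [mem_insert, YoungDiagram.mem_cells, YoungDiagram.mem_cells,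
        YoungDiagram.mem_iff_lt_rowLen, YoungDiagram.mem_iff_lt_rowLen, h j, Prod.mk_inj]
      split_ifs with hj
      · subst hj
        omega
      · omega

variable {d : ℕ}

lemma shiftedRows_mem_weylChamber (μ : YoungDiagram) : shiftedRows d μ ∈ weylChamber d := by
  refine ⟨fun i j hij => ?_, fun i => ?_⟩
  · have h := μ.rowLen_anti i j hij.le
    have h' : (i : ℕ) < j := hij
    simp only [shiftedRows]
    omega
  · have := i.isLt
    simp only [shiftedRows]
    omega

lemma shiftedRows_injOn : Set.InjOn (shiftedRows d) {μ | μ.colLen 0 ≤ d} := by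
  intro μ hμ ν hν h
  refine YoungDiagram.ext_rowLen fun i => ?_
  by_cases hi : i < d
  · have := congrFun h ⟨i, hi⟩
    simp only [shiftedRows] at this
    omega
  · rw [YoungDiagram.rowLen_eq_zero hμ (not_lt.1 hi), YoungDiagram.rowLen_eq_zero hν (not_lt.1 hi)]

lemma addsSquare_iff_shiftedRows {μ ν : YoungDiagram} (hμ : μ.colLen 0 ≤ d) (hν : ν.colLen 0 ≤ d) :
    AddsSquare μ ν ↔ ∃ i, shiftedRows d ν = shiftedRows d μ + Pi.single i 1 := by
  rw [addsSquare_iff_rowLen]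
  constructor
  · rintro ⟨i, h⟩
    have hi : i < d := by
      by_contra hi
      have := h i
      rw [YoungDiagram.rowLen_eq_zero hν (not_lt.1 hi)] at this
      simp at this
    refine ⟨⟨i, hi⟩, funext fun j => ?_⟩
    simp only [shiftedRows, h j, Pi.add_apply, Pi.single_apply, Fin.ext_iff]
    split_ifs <;> push_cast <;> ring
  · rintro ⟨i, h⟩
    refine ⟨i, fun j => ?_⟩
    by_cases hj : j < d
    · have := congrFun h ⟨j, hj⟩
      simp only [shiftedRows, Pi.add_apply, Pi.single_apply, Fin.ext_iff] at this
      split_ifs at this ⊢ <;> omega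
    · rw [YoungDiagram.rowLen_eq_zero hμ (not_lt.1 hj),
        YoungDiagram.rowLen_eq_zero hν (not_lt.1 hj), if_neg]
      have := i.isLt
      omega

/-- A strictly decreasing integer sequence drops by at least one per index. -/
lemma antitone_sub_weylStart {a : Fin d → ℤ} (ha : StrictAnti a) :
    Antitone fun i => a i - weylStart d i := by
  have key : ∀ (k : ℕ) (i j : Fin d), (j : ℕ) = i + k → a j + k ≤ a i := by
    intro k
    induction k with
    | zero =>
      intro i j h
      rw [Fin.ext (h.trans (add_zero _))]
      simp
    | succ k ih =>
      intro i j h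
      have hlt : (i : ℕ) + k < d := by have := j.isLt; omega
      have h1 := ih i ⟨i + k, hlt⟩ rfl
      have h2 : a j < a ⟨i + k, hlt⟩ := ha (Fin.lt_def.2 (by simp [h]))
      push_cast
      omega
  intro i j hij
  have h' : (i : ℕ) ≤ j := hij
  have := key (j - i) i j (by omega)
  simp only [weylStart]
  omega

lemma weylStart_le {a : Fin d → ℤ} (ha : a ∈ weylChamber d) (i : Fin d) : weylStart d i ≤ a i := by
  have hd : d - 1 < d := by have := i.isLt; omega
  have h1 := antitone_sub_weylStart ha.1 (show i ≤ ⟨d - 1, hd⟩ from Fin.le_def.2 (by simp; omega))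
  have h2 := ha.2 ⟨d - 1, hd⟩
  simp only [weylStart] at h1 ⊢
  omega

lemma exists_shiftedRows_eq {a : Fin d → ℤ} (ha : a ∈ weylChamber d) :
    ∃ μ : YoungDiagram, μ.colLen 0 ≤ d ∧ shiftedRows d μ = a := by
  have hr : Antitone fun i => (a i - weylStart d i).toNat := fun i j hij =>
    Int.toNat_le_toNat (antitone_sub_weylStart ha.1 hij)
  -- The truncation `toNat` loses nothing, by `weylStart_le`.
  set μ := YoungDiagram.ofRowLens (List.ofFn fun i => (a i - weylStart d i).toNat)
    hr.sortedGE_ofFn with hμ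
  have hmem : ∀ i j, (i, j) ∈ μ ↔ ∃ h : i < d, j < (a ⟨i, h⟩ - weylStart d ⟨i, h⟩).toNat := by
    intro i j
    rw [hμ, YoungDiagram.mem_ofRowLens]
    simp
  refine ⟨μ, ?_, funext fun i => ?_⟩
  · by_contra h
    obtain ⟨h', -⟩ := (hmem d 0).1 (YoungDiagram.mem_iff_lt_colLen.2 (not_le.1 h))
    exact lt_irrefl _ h'
  · have h1 : μ.rowLen i = (a i - weylStart d i).toNat := by
      refine eq_of_forall_lt_iff fun k => ?_
      rw [← YoungDiagram.mem_iff_lt_rowLen, hmem]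
      simp
    have h2 := weylStart_le ha i
    simp only [shiftedRows, h1]
    simp only [weylStart] at h2 ⊢
    omega

lemma weylStart_mem_weylChamber (d : ℕ) : weylStart d ∈ weylChamber d := by
  refine ⟨fun i j hij => ?_, fun i => ?_⟩
  · have h' : (i : ℕ) < j := hij
    simp only [weylStart]
    omega
  · have := i.isLt
    simp only [weylStart]
    omega

lemma shiftedRows_bot (d : ℕ) : shiftedRows d ⊥ = weylStart d := by
  ext i
  have : (⊥ : YoungDiagram).rowLen i = 0 := by
    by_contra h
    exact YoungDiagram.notMem_bot _ (YoungDiagram.mem_iff_lt_rowLen.2 (Nat.pos_of_ne_zero h))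
  simp [shiftedRows, weylStart, this]

lemma colLen_bot_zero_le (d : ℕ) : (⊥ : YoungDiagram).colLen 0 ≤ d := by
  by_contra h
  exact YoungDiagram.notMem_bot _ (YoungDiagram.mem_iff_lt_colLen.2 (not_le.1 h))

lemma addsSquare_or_iff {μ ν : YoungDiagram} (hμ : μ.colLen 0 ≤ d) (hν : ν.colLen 0 ≤ d) :
    AddsSquare μ ν ∨ AddsSquare ν μ ↔ ∃ i, shiftedRows d ν = shiftedRows d μ + Pi.single i 1 ∨
      shiftedRows d ν = shiftedRows d μ - Pi.single i 1 := by
  rw [addsSquare_iff_shiftedRows hμ hν, addsSquare_iff_shiftedRows hν hμ, exists_or]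
  simp only [eq_sub_iff_add_eq, eq_comm (a := shiftedRows d μ)]

lemma injOn_oscillatingTableaux (n : ℕ) :
    Set.InjOn (fun (μ : Fin (n + 1) → YoungDiagram) k => shiftedRows d (μ k))
      (oscillatingTableaux d n) :=
  fun _ hμ _ hν h => funext fun k => shiftedRows_injOn (hμ.2.1 k) (hν.2.1 k) (congrFun h k)

lemma image_oscillatingTableaux (d n : ℕ) :
    (fun (μ : Fin (n + 1) → YoungDiagram) k => shiftedRows d (μ k)) '' oscillatingTableaux d n =
      walksFrom d n (weylStart d) := by
  ext w
  constructor
  · rintro ⟨μ, ⟨h0, h1, h2⟩, rfl⟩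
    exact ⟨by simp only [h0, shiftedRows_bot], fun k => shiftedRows_mem_weylChamber _,
      fun k => (addsSquare_or_iff (h1 _) (h1 _)).1 (h2 k)⟩
  · rintro ⟨h0, h1, h2⟩
    choose μ hμ hw using fun k => exists_shiftedRows_eq (h1 k)
    refine ⟨μ, ⟨?_, hμ, fun k => ?_⟩, funext hw⟩
    · exact shiftedRows_injOn (hμ 0) (colLen_bot_zero_le d) (by rw [hw, h0, shiftedRows_bot])
    · rw [addsSquare_or_iff (hμ _) (hμ _), hw, hw]
      exact h2 k

lemma finite_oscillatingTableaux (d n : ℕ) : (oscillatingTableaux d n).Finite :=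
  Set.Finite.of_finite_image (image_oscillatingTableaux d n ▸ finite_walksFrom n _)
    (injOn_oscillatingTableaux n)

lemma ncard_oscillatingTableaux (d n : ℕ) :
    (oscillatingTableaux d n).ncard = (walksFrom d n (weylStart d)).ncard := by
  rw [← image_oscillatingTableaux, (injOn_oscillatingTableaux n).ncard_image]

end Tableaux

open MvLaurent in
lemma expGenFun_ncard_walksFrom (d : ℕ) :
    expGenFun (fun n => (walksFrom d n (weylStart d)).ncard) =
      Matrix.det (Matrix.of fun i j : Fin d => besselJ ((i : ℤ) - (j : ℤ))) := by
  ext n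
  have hn : (n.factorial : ℚ) ≠ 0 := by exact_mod_cast n.factorial_ne_zero
  rw [expGenFun, PowerSeries.coeff_mk, div_eq_iff hn, mul_comm _ (n.factorial : ℚ),
    factorial_mul_coeff_det_besselJ, ncard_walksFrom n (weylStart_mem_weylChamber d),
    reflectedCount, signedOrbit]
  exact functional_sortSign_prod_mul_eq_constTerm_det_mul fun σ => permVars_stepSum_pow σ n

end

theorem theorem2 (d : ℕ) :
    -- the counts below are counts of finite sets, and the sum over the end points is finite
    (∀ (n : ℕ) (b : Fin d → ℤ), (weylWalks d n (weylStart d) b).Finite) ∧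
    (∀ n : ℕ, {b ∈ weylChamber d | weylWalkCount d n (weylStart d) b ≠ 0}.Finite) ∧
    (∀ n : ℕ, (oscillatingTableaux d n).Finite) ∧
    -- the constant-term descriptions of `I_s(2t)` and `J_s(2t)`
    (∀ s : ℤ, besselI s = zCoeff s expKernel) ∧
    (∀ s : ℤ, besselJ s =
      zCoeff s (PowerSeries.C (1 + LaurentPolynomial.T 1) * expKernel)) ∧
    -- lattice walks starting at `(d, d - 1, …, 1)` and ending anywhere
    expGenFun (fun n => ∑ᶠ b ∈ weylChamber d, weylWalkCount d n (weylStart d) b) =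
      Matrix.det (Matrix.of fun i j : Fin d => besselJ ((i : ℤ) - (j : ℤ))) ∧
    -- oscillating tableaux of height at most `d` and of any shape
    expGenFun (fun n => (oscillatingTableaux d n).ncard) =
      Matrix.det (Matrix.of fun i j : Fin d => besselJ ((i : ℤ) - (j : ℤ))) := by
  refine ⟨fun n b => finite_weylWalks n _ b, fun n => finite_setOf_weylWalkCount_ne_zero n _,
    finite_oscillatingTableaux d, besselI_eq_zCoeff, besselJ_eq_zCoeff, ?_, ?_⟩
  · simp only [finsum_weylWalkCount]
    exact expGenFun_ncard_walksFrom d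
  · simp only [ncard_oscillatingTableaux]
    exact expGenFun_ncard_walksFrom d
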